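/- Conventions. For a subset $A$ of $\mathbb{N}=\{0,1,2,\dots\}$, $\langle A\rangle$ is the submonoid of $(\mathbb{N},+)$ generated by $A$; $A$ is $\mathbb{N}$-independent if $a\notin\langle A\setminus\{a\}\rangle$ for all $a\in A$. For a submonoid $S$ of $\mathbb{N}$ and $d\ge 1$, $S/d=\{x\in\mathbb{N} : dx\in S\}$, and $\mathrm{Irr}(S)$ is the set of nonzero elements of $S$ that are not the sum of two positive elements of $S$. A finite sequence $(n_0,\dots,n_r)$ is modular-convex if for every $k\in\{1,\dots,r-1\}$ there is $c_k\in\mathbb{N}$ with $n_{k-1}+n_{k+1}=(c_k+2)n_k$. A sequence enumerates $I$ if it lists every element of $I$ exactly once. Theorem. Let $I$ be a finite subset of $\mathbb{N}\setminus\{0,1\}$. Call a sequence $(n_0,\dots,n_r)$ admissible for $I$ if $I$ is $\mathbb{N}$-independent and the sequence enumerates $I$, is modular-convex, and satisfies $\gcd(n_0,n_r)=1$ and $n_0<n_r$ (so $r\ge 1$). (i) If $(n_0,\dots,n_r)$ is admissible for $I$, put $a=n_0$ and $b=n_r$. There is exactly one $d\in\{1,\dots,a-1\}$ with $dn_1\equiv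 b \pmod a$, and for this $d$ one has $I=\mathrm{Irr}(\langle a,b\rangle/d)$. (ii) The map $(n_0,\dots,n_r)\mapsto(a,b,d)$ of (i) is a bijection from the set of sequences admissible for $I$ onto the set of triples $(a,b,d)$ of pairwise coprime positive integers such that $1\le d<a<b$ and $I=\mathrm{Irr}(\langle a,b\rangle/d)$. Moreover $d>1$ if and only if $r\ge 2$; hence the map restricts to a bijection from the admissible sequences with $r\ge 2$ onto the triples with $1<d<a<b$, and, when $I$ does not have exactly two elements, there are as many triples of pairwise coprime integers with $1<d<a<b$ and $I=\mathrm{Irr}(\langle a,b\rangle/d)$ as there are sequences admissible for $I$. -/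

import Mathlib

namespace NumSemigroup

/-- The quotient `S / d = {x ∈ ℕ | d * x ∈ S}` of a submonoid `S` of `ℕ`. -/
def quotient (S : AddSubmonoid ℕ) (d : ℕ) : AddSubmonoid ℕ where
  carrier := {x | d * x ∈ S}
  zero_mem' := by simp
  add_mem' := by
    intro x y hx hy
    change d * (x + y) ∈ S
    rw [mul_add]
    exact S.add_mem hx hy

/-- `⟨a, b⟩ / d`, where `⟨a, b⟩` is the submonoid of `ℕ` generated by `a` and `b`. -/
def quotPair (a b d : ℕ) : AddSubmonoid ℕ :=
  quotient (AddSubmonoid.closure {a, b}) d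

/-- The set of irreducible elements of a submonoid `S` of `ℕ`: the nonzero elements of `S` that
are not a sum of two positive elements of `S`. -/
def Irr (S : AddSubmonoid ℕ) : Set ℕ :=
  {s | s ∈ S ∧ s ≠ 0 ∧ ∀ x ∈ S, ∀ y ∈ S, 0 < x → 0 < y → s ≠ x + y}

/-- A subset `A` of a (commutative, additive) monoid is `ℕ`-independent if no element `a` of `A`
lies in the submonoid generated by `A \ {a}`. -/
def NIndependent {M : Type*} [AddCommMonoid M] (A : Set M) : Prop :=
  ∀ a ∈ A, a ∉ AddSubmonoid.closure (A \ {a})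

/-- A finite sequence `u 0, …, u r` is modular-convex if for every interior index `k` there is
`c : ℕ` with `u (k-1) + u (k+1) = (c + 2) • u k`. -/
def IsModularConvex {M : Type*} [AddCommMonoid M] {r : ℕ} (u : Fin (r + 1) → M) : Prop :=
  ∀ (i : ℕ) (h : i + 2 < r + 1), ∃ c : ℕ,
    u ⟨i, by omega⟩ + u ⟨i + 2, h⟩ = (c + 2) • u ⟨i + 1, by omega⟩

/-- The set `I` is `ℕ`-independent and `n 0, …, n r` is an enumeration (without repetition) of
`I` which is modular-convex and satisfies `gcd (n 0, n r) = 1` and `n 0 < n r`. -/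
structure IsAdmissible (I : Set ℕ) {r : ℕ} (n : Fin (r + 1) → ℕ) : Prop where
  indep : NIndependent I
  injective : Function.Injective n
  range_eq : Set.range n = I
  modularConvex : IsModularConvex n
  coprime : Nat.Coprime (n 0) (n (Fin.last r))
  lt : n 0 < n (Fin.last r)

/-- The type of all sequences `n 0, …, n r` (of any length) that are admissible for `I`. -/
def AdmissibleSeq (I : Set ℕ) : Type :=
  {s : Σ r : ℕ, Fin (r + 1) → ℕ // IsAdmissible I s.2}

/-- The type of all triples `(a, b, d)` of pairwise coprime positive integers such that
`d < a < b` and `I = Irr (⟨a, b⟩ / d)`. -/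
structure SolutionTriple (I : Set ℕ) where
  a : ℕ
  b : ℕ
  d : ℕ
  coprime_ab : Nat.Coprime a b
  coprime_ad : Nat.Coprime a d
  coprime_bd : Nat.Coprime b d
  one_le_d : 1 ≤ d
  d_lt_a : d < a
  a_lt_b : a < b
  eq_irr : I = Irr (quotPair a b d)

end NumSemigroup

namespace NumSemigroup

/-! Let L be the lattice of (s, t) with d ∣ s a + t b. The map (s, t) ↦ (s a + t b)/d carries its
nonnegative vectors onto ⟨a, b⟩/d. Those vectors are generated by a chain (q k, p k) from (d, 0) to
(0, d); consecutive vectors have determinant d, so they form a basis of L and cut the quadrant into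
unimodular cones (`exists_combination`). As d < a < b, no other nonnegative vector has the same
image as a chain vector, so irreducibility survives the map and Irr is the image of the chain
(`irr_eq_range`).

A triple yields its chain through a Hirzebruch–Jung continued fraction. Conversely, the coefficients
c k of a modular-convex sequence rebuild p and q by recurrence, with d = p r, and independence
forces d < a. Finally p k is the residue of d n k / b modulo a and increases with k, so (a, b, d)
fixes the order in which I is listed. -/

/-- The solution with initial values `x`, `y` of the three-term recurrence
`u k + u (k + 2) = (c k + 2) * u (k + 1)`. -/
def recSeq (c : ℕ → ℕ) (x y : ℤ) : ℕ → ℤ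
  | 0 => x
  | 1 => y
  | k + 2 => (c k + 2) * recSeq c x y (k + 1) - recSeq c x y k

theorem recSeq_rec (c : ℕ → ℕ) (x y : ℤ) (k : ℕ) :
    recSeq c x y k + recSeq c x y (k + 2) = (c k + 2) * recSeq c x y (k + 1) := by
  simp [recSeq]

/-- Since c k ≥ 0, the increments of p do not decrease as long as p stays nonnegative. -/
theorem nonneg_and_lt_succ_of_rec {c : ℕ → ℕ} {p : ℕ → ℤ} {r : ℕ} (hp0 : p 0 = 0)
    (hp1 : p 1 = 1) (hp : ∀ k, k + 2 ≤ r → p k + p (k + 2) = (c k + 2) * p (k + 1)) (k : ℕ)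
    (hk : k + 1 ≤ r) : 0 ≤ p k ∧ p k < p (k + 1) := by
  induction k with
  | zero => simp [hp0, hp1]
  | succ k ih =>
    obtain ⟨h1, h2⟩ := ih (by omega)
    have h3 := hp k hk
    have : (0 : ℤ) ≤ c k * p (k + 1) := mul_nonneg (by positivity) (by omega)
    constructor
    · omega
    · change p (k + 1) < p (k + 2)
      linarith

theorem lt_of_rec {c : ℕ → ℕ} {p : ℕ → ℤ} {r : ℕ} (hp0 : p 0 = 0) (hp1 : p 1 = 1)
    (hp : ∀ k, k + 2 ≤ r → p k + p (k + 2) = (c k + 2) * p (k + 1)) {k l : ℕ} (hkl : k < l)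
    (hl : l ≤ r) : p k < p l := by
  induction l, hkl using Nat.le_induction with
  | base => exact (nonneg_and_lt_succ_of_rec hp0 hp1 hp k hl).2
  | succ l _ ih =>
    exact (ih (by omega)).trans (nonneg_and_lt_succ_of_rec hp0 hp1 hp l hl).2

/-! ### Chains of lattice vectors in the quadrant -/

/-- The vectors `(q k, p k)`, `0 ≤ k ≤ r`, run from `(d, 0)` to `(0, d)` along the boundary of
the convex hull of the nonzero nonnegative vectors of the lattice which they generate. -/
structure IsHilbertChain (c : ℕ → ℕ) (d : ℤ) (r : ℕ) (p q : ℕ → ℤ) : Prop where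
  one_le : 1 ≤ r
  p_zero : p 0 = 0
  p_one : p 1 = 1
  p_last : p r = d
  q_zero : q 0 = d
  q_last : q r = 0
  p_rec : ∀ k, k + 2 ≤ r → p k + p (k + 2) = (c k + 2) * p (k + 1)
  q_rec : ∀ k, k + 2 ≤ r → q k + q (k + 2) = (c k + 2) * q (k + 1)

namespace IsHilbertChain

variable {c : ℕ → ℕ} {d : ℤ} {r : ℕ} {p q : ℕ → ℤ}

theorem p_lt (h : IsHilbertChain c d r p q) {k l : ℕ} (hkl : k < l) (hl : l ≤ r) : p k < p l :=
  lt_of_rec h.p_zero h.p_one h.p_rec hkl hl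

theorem p_le (h : IsHilbertChain c d r p q) {k l : ℕ} (hkl : k ≤ l) (hl : l ≤ r) : p k ≤ p l := by
  rcases hkl.eq_or_lt with rfl | hkl
  · exact le_rfl
  · exact (h.p_lt hkl hl).le

theorem p_nonneg (h : IsHilbertChain c d r p q) {k : ℕ} (hk : k ≤ r) : 0 ≤ p k :=
  h.p_zero ▸ h.p_le k.zero_le hk

theorem p_le_d (h : IsHilbertChain c d r p q) {k : ℕ} (hk : k ≤ r) : p k ≤ d :=
  h.p_last ▸ h.p_le hk le_rfl

theorem d_pos (h : IsHilbertChain c d r p q) : 0 < d := by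
  have := h.p_lt (k := 0) h.one_le le_rfl
  rwa [h.p_zero, h.p_last] at this

theorem one_lt_d_iff (h : IsHilbertChain c d r p q) : 1 < d ↔ 2 ≤ r := by
  constructor
  · intro hd
    by_contra hr
    obtain rfl : r = 1 := by have := h.one_le; omega
    have := h.p_one
    have := h.p_last
    omega
  · intro hr
    have := h.p_lt (k := 1) (l := r) hr le_rfl
    rwa [h.p_one, h.p_last] at this

/-- Each step of the recurrence has determinant 1, so the value at k = 0 persists. -/
theorem det (h : IsHilbertChain c d r p q) {k : ℕ} (hk : k + 1 ≤ r) :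
    q k * p (k + 1) - q (k + 1) * p k = d := by
  induction k with
  | zero => simp [h.p_zero, h.p_one, h.q_zero]
  | succ k ih =>
    have h1 := ih (by omega)
    have h2 := h.p_rec k hk
    have h3 := h.q_rec k hk
    change q (k + 1) * p (k + 2) - q (k + 2) * p (k + 1) = d
    linear_combination h1 + q (k + 1) * h2 - p (k + 1) * h3

/-- Descend from q r = 0: by `det`, q k * p (k + 1) = d + q (k + 1) * p k > 0. -/
theorem q_nonneg (h : IsHilbertChain c d r p q) {k : ℕ} (hk : k ≤ r) : 0 ≤ q k := by
  induction hk using Nat.decreasingInduction with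
  | self => exact h.q_last.ge
  | of_succ k hk ih =>
    have h1 := h.det hk
    have h2 := h.p_lt (Nat.succ_pos k) hk
    rw [h.p_zero] at h2
    have h3 := mul_nonneg ih (h.p_nonneg (Nat.le_of_lt hk))
    have h4 := h.d_pos
    by_contra! h5
    have := mul_neg_of_neg_of_pos h5 h2
    simp only [Nat.succ_eq_add_one] at *
    linarith

theorem q_pred_last (h : IsHilbertChain c d r p q) : q (r - 1) = 1 := by
  have h1 := h.one_le
  have h2 := h.det (k := r - 1) (by omega)
  rw [Nat.sub_add_cancel h1, h.q_last, h.p_last] at h2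
  exact mul_right_cancel₀ h.d_pos.ne' (by linarith)

theorem q_succ_lt (h : IsHilbertChain c d r p q) {k : ℕ} (hk : k < r) : q (k + 1) < q k := by
  have h1 := h.one_le
  have hk' : k ≤ r - 1 := by omega
  induction hk' using Nat.decreasingInduction with
  | self => rw [Nat.sub_add_cancel h1, h.q_last, h.q_pred_last]; norm_num
  | of_succ k hk' ih =>
    have h2 := ih (by omega)
    have h3 := h.q_rec k (by omega)
    have h4 : (0 : ℤ) ≤ c k * q (k + 1) := mul_nonneg (by positivity) (h.q_nonneg (by omega))
    change q (k + 2) < q (k + 1) at h2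
    linarith

theorem q_lt (h : IsHilbertChain c d r p q) {k l : ℕ} (hkl : k < l) (hl : l ≤ r) :
    q l < q k := by
  induction l, hkl using Nat.le_induction with
  | base => exact h.q_succ_lt hl
  | succ l _ ih => exact (h.q_succ_lt hl).trans (ih (by omega))

theorem q_le_d (h : IsHilbertChain c d r p q) {k : ℕ} (hk : k ≤ r) : q k ≤ d := by
  rcases k.eq_zero_or_pos with rfl | hk0
  · exact h.q_zero.le
  · exact h.q_zero ▸ (h.q_lt hk0 hk).le

/-- The chain is an antichain: p strictly increases while q strictly decreases. -/
theorem eq_of_le (h : IsHilbertChain c d r p q) {k l : ℕ} (hk : k ≤ r) (hl : l ≤ r)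
    (hp : p k ≤ p l) (hq : q k ≤ q l) : k = l := by
  rcases lt_trichotomy k l with h1 | h1 | h1
  · exact absurd (h.q_lt h1 hl) hq.not_gt
  · exact h1
  · exact absurd (h.p_lt h1 hk) hp.not_gt

/-- The side of the ray through (q k, p k) on which (s, t) lies must change between k = 0 and k = r.
-/
theorem exists_cone (h : IsHilbertChain c d r p q) {s t : ℤ} (hs : 0 ≤ s) (ht : 0 ≤ t) :
    ∃ k, k + 1 ≤ r ∧ 0 ≤ s * p (k + 1) - t * q (k + 1) ∧ 0 ≤ t * q k - s * p k := by
  by_contra! hcon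
  have key : ∀ m, m + 1 ≤ r → 0 ≤ t * q m - s * p m := by
    intro m
    induction m with
    | zero => intro _; rw [h.p_zero, h.q_zero]; nlinarith [h.d_pos]
    | succ m ih =>
      intro hm
      by_contra! hneg
      have h1 := hcon m (by omega) (by linarith)
      exact absurd (ih (by omega)) h1.not_ge
  have h1 := h.one_le
  have h2 := hcon (r - 1) (by omega)
  rw [Nat.sub_add_cancel h1, h.q_last, h.p_last] at h2
  have h3 := h2 (by nlinarith [h.d_pos])
  exact absurd (key (r - 1) (by omega)) h3.not_ge

/-- Every nonnegative vector of the lattice is a nonnegative combination of two neighbours. -/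
theorem exists_combination (h : IsHilbertChain c d r p q) {a b : ℤ} (had : IsCoprime a d)
    (hdvd : ∀ k ≤ r, d ∣ q k * a + p k * b) {s t : ℤ} (hs : 0 ≤ s) (ht : 0 ≤ t)
    (hst : d ∣ s * a + t * b) :
    ∃ k, k + 1 ≤ r ∧ ∃ x y : ℕ, s = x * q k + y * q (k + 1) ∧ t = x * p k + y * p (k + 1) := by
  obtain ⟨k, hk, h1, h2⟩ := h.exists_cone hs ht
  have hdet := h.det hk
  have hd := h.d_pos
  -- Cramer's rule: the two determinants are d times the coordinates. Eliminating b leaves a times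
  -- the determinant, and a is a unit modulo d.
  have hx : d ∣ s * p (k + 1) - t * q (k + 1) := by
    refine had.symm.dvd_of_dvd_mul_left ?_
    have := dvd_sub (hst.mul_left (p (k + 1))) ((hdvd (k + 1) hk).mul_left t)
    convert this using 1
    ring
  have hy : d ∣ t * q k - s * p k := by
    refine had.symm.dvd_of_dvd_mul_left ?_
    have := dvd_sub ((hdvd k (by omega)).mul_left t) (hst.mul_left (p k))
    convert this using 1
    ring
  obtain ⟨x, hx⟩ := hx
  obtain ⟨y, hy⟩ := hy
  have hx0 : 0 ≤ x := nonneg_of_mul_nonneg_right (hx ▸ h1) hd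
  have hy0 : 0 ≤ y := nonneg_of_mul_nonneg_right (hy ▸ h2) hd
  lift x to ℕ using hx0
  lift y to ℕ using hy0
  refine ⟨k, hk, x, y, ?_, ?_⟩
  · apply mul_left_cancel₀ hd.ne'
    linear_combination q k * hx + q (k + 1) * hy - s * hdet
  · apply mul_left_cancel₀ hd.ne'
    linear_combination p k * hx + p (k + 1) * hy - t * hdet

/-- Every vector `(q k, p k)` is irreducible among the nonnegative vectors of the lattice. -/
theorem eq_zero_of_add_eq (h : IsHilbertChain c d r p q) {a b : ℤ} (had : IsCoprime a d)
    (hdvd : ∀ k ≤ r, d ∣ q k * a + p k * b) {s t s' t' : ℤ} (hs : 0 ≤ s) (ht : 0 ≤ t)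
    (hs' : 0 ≤ s') (ht' : 0 ≤ t') (hst : d ∣ s * a + t * b) {k : ℕ} (hk : k ≤ r)
    (hq : s + s' = q k) (hp : t + t' = p k) : (s = 0 ∧ t = 0) ∨ (s' = 0 ∧ t' = 0) := by
  obtain ⟨j, hj, x, y, hx, hy⟩ := h.exists_combination had hdvd hs ht hst
  have q1 := h.q_nonneg (show j ≤ r by omega)
  have q2 := h.q_nonneg hj
  have p1 := h.p_nonneg (show j ≤ r by omega)
  have p2 := h.p_nonneg hj
  -- A chain vector below (s, t) is below (q k, p k), hence equal to it, and nothing remains for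
  -- (s', t').
  have key : ∀ i ≤ r, q i ≤ s → p i ≤ t → s' = 0 ∧ t' = 0 := by
    intro i hi h1 h2
    obtain rfl := h.eq_of_le hi hk (by omega) (by omega)
    omega
  rcases Nat.eq_zero_or_pos x with rfl | hx0
  · rcases Nat.eq_zero_or_pos y with rfl | hy0
    · left; simp [hx, hy]
    · right
      have hy1 : (1 : ℤ) ≤ y := by exact_mod_cast hy0
      exact key (j + 1) hj (by rw [hx]; push_cast; nlinarith) (by rw [hy]; push_cast; nlinarith)
  · right
    have hx1 : (1 : ℤ) ≤ x := by exact_mod_cast hx0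
    exact key j (by omega) (by rw [hx]; nlinarith [mul_nonneg (Int.natCast_nonneg y) q2])
      (by rw [hy]; nlinarith [mul_nonneg (Int.natCast_nonneg y) p2])

end IsHilbertChain

/-! ### Irreducibles and generators -/

theorem exists_eq_add_of_mem_closure {A : Set ℕ} {x : ℕ} (hx : x ∈ AddSubmonoid.closure A)
    (hx0 : x ≠ 0) : ∃ y ∈ A, ∃ z ∈ AddSubmonoid.closure A, x = y + z := by
  induction hx using AddSubmonoid.closure_induction_left with
  | zero => exact absurd rfl hx0
  | add_left y hy z hz _ => exact ⟨y, hy, z, hz, rfl⟩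

theorem nIndependent_irr (S : AddSubmonoid ℕ) : NIndependent (Irr S) := by
  rintro s ⟨-, hs0, hs⟩ hmem
  have hle : AddSubmonoid.closure (Irr S \ {s}) ≤ S :=
    (AddSubmonoid.closure_le).2 fun x hx => hx.1.1
  obtain ⟨y, hy, z, hz, rfl⟩ := exists_eq_add_of_mem_closure hmem hs0
  have hz0 : z ≠ 0 := by
    rintro rfl
    exact hy.2 (by simp)
  exact hs y hy.1.1 z (hle hz) (Nat.pos_of_ne_zero hy.1.2.1) (Nat.pos_of_ne_zero hz0) rfl

theorem mem_of_mem_irr_closure {A : Set ℕ} {x : ℕ}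
    (hx : x ∈ Irr (AddSubmonoid.closure A)) : x ∈ A := by
  obtain ⟨hmem, hx0, hirr⟩ := hx
  by_contra hxA
  -- Discarding 0 from the generators makes the summand y nonzero.
  rw [← AddSubmonoid.closure_sdiff_singleton_zero] at hmem
  obtain ⟨y, hy, z, hz, rfl⟩ := exists_eq_add_of_mem_closure hmem hx0
  rw [AddSubmonoid.closure_sdiff_singleton_zero] at hz
  have hz0 : z ≠ 0 := by
    rintro rfl
    exact hxA hy.1
  exact hirr y (AddSubmonoid.subset_closure hy.1) z hz (Nat.pos_of_ne_zero hy.2)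
    (Nat.pos_of_ne_zero hz0) rfl

theorem mem_quotPair {a b d x : ℕ} :
    x ∈ quotPair a b d ↔ ∃ s t : ℕ, s * a + t * b = d * x := by
  change d * x ∈ AddSubmonoid.closure {a, b} ↔ _
  rw [AddSubmonoid.mem_closure_pair]
  simp

/-! ### From chains to quotients of ⟨a, b⟩ -/

/-- The numbers `n k = (q k * a + p k * b) / d` attached to a chain of vectors `(q k, p k)`. -/
structure IsResolution (a b d : ℕ) {r : ℕ} (n : Fin (r + 1) → ℕ) (c : ℕ → ℕ) (p q : ℕ → ℤ) :
    Prop where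
  chain : IsHilbertChain c d r p q
  rel : ∀ k : Fin (r + 1), (d : ℤ) * n k = q k * a + p k * b
  coprime_ab : Nat.Coprime a b
  coprime_ad : Nat.Coprime a d
  d_lt_a : d < a

namespace IsResolution

variable {a b d r : ℕ} {n : Fin (r + 1) → ℕ} {c : ℕ → ℕ} {p q : ℕ → ℤ}

theorem dvd (h : IsResolution a b d n c p q) : ∀ k ≤ r, (d : ℤ) ∣ q k * a + p k * b :=
  fun k hk => ⟨n ⟨k, by omega⟩, (h.rel ⟨k, by omega⟩).symm⟩

theorem quotPair_eq (h : IsResolution a b d n c p q) :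
    quotPair a b d = AddSubmonoid.closure (Set.range n) := by
  have hd := h.chain.d_pos
  apply le_antisymm
  · intro x hx
    obtain ⟨s, t, hst⟩ := mem_quotPair.1 hx
    have hst' : (s : ℤ) * a + t * b = d * x := by exact_mod_cast hst
    obtain ⟨k, hk, y, z, hy, hz⟩ := h.chain.exists_combination (Nat.isCoprime_iff_coprime.2
      h.coprime_ad) h.dvd (Int.natCast_nonneg s) (Int.natCast_nonneg t) ⟨x, hst'⟩
    have h1 := h.rel ⟨k, by omega⟩
    have h2 := h.rel ⟨k + 1, by omega⟩
    simp only at h1 h2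
    have hx : x = y • n ⟨k, by omega⟩ + z • n ⟨k + 1, by omega⟩ := by
      rw [smul_eq_mul, smul_eq_mul]
      zify
      apply mul_left_cancel₀ hd.ne'
      linear_combination -hst' + (a : ℤ) * hy + (b : ℤ) * hz - y * h1 - z * h2
    rw [hx]
    exact add_mem (AddSubmonoid.nsmul_mem _ (AddSubmonoid.subset_closure (Set.mem_range_self _)) _)
      (AddSubmonoid.nsmul_mem _ (AddSubmonoid.subset_closure (Set.mem_range_self _)) _)
  · rw [AddSubmonoid.closure_le]
    rintro _ ⟨k, rfl⟩
    have hk : (k : ℕ) ≤ r := by omega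
    refine mem_quotPair.2 ⟨(q k).toNat, (p k).toNat, ?_⟩
    zify
    rw [Int.toNat_of_nonneg (h.chain.q_nonneg hk), Int.toNat_of_nonneg (h.chain.p_nonneg hk),
      h.rel]

theorem p_lt_a (h : IsResolution a b d n c p q) {k : ℕ} (hk : k ≤ r) : p k < a :=
  (h.chain.p_le_d hk).trans_lt (by exact_mod_cast h.d_lt_a)

/-- The coordinate `p k` is a function of the number `n k`. -/
theorem emod_eq (h : IsResolution a b d n c p q) {β : ℤ} (hβ : (a : ℤ) ∣ b * β - 1)
    (k : Fin (r + 1)) : (d * n k * β) % a = p k := by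
  have hk : (k : ℕ) ≤ r := by omega
  have h1 : (a : ℤ) ∣ d * n k * β - p k := by
    obtain ⟨w, hw⟩ := hβ
    exact ⟨p k * w + q k * β, by linear_combination β * h.rel k + p k * hw⟩
  rw [← (Int.modEq_iff_dvd.2 h1).eq, Int.emod_eq_of_lt (h.chain.p_nonneg hk) (h.p_lt_a hk)]

theorem exists_inverse (h : IsResolution a b d n c p q) : ∃ β : ℤ, (a : ℤ) ∣ b * β - 1 := by
  obtain ⟨u, v, huv⟩ := Nat.isCoprime_iff_coprime.2 h.coprime_ab
  exact ⟨v, -u, by linear_combination huv⟩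

theorem strictMono_p (h : IsResolution a b d n c p q) :
    StrictMono fun k : Fin (r + 1) => p k :=
  fun _ l hkl => h.chain.p_lt hkl (by omega)

theorem injective (h : IsResolution a b d n c p q) : Function.Injective n := by
  obtain ⟨β, hβ⟩ := h.exists_inverse
  intro k l hkl
  apply h.strictMono_p.injective
  simp only
  rw [← h.emod_eq hβ k, ← h.emod_eq hβ l, hkl]

/-- One function g, depending only on a, b, d, turns both sequences into strictly increasing ones
with the same range. -/
theorem eq_of_range_eq {n' : Fin (r + 1) → ℕ} {c' : ℕ → ℕ} {p' q' : ℕ → ℤ}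
    (h : IsResolution a b d n c p q) (h' : IsResolution a b d n' c' p' q')
    (hr : Set.range n = Set.range n') : n = n' := by
  obtain ⟨β, hβ⟩ := h.exists_inverse
  let g : ℕ → ℤ := fun x => (d * x * β) % a
  have hg : g ∘ n = fun k : Fin (r + 1) => p k := funext (h.emod_eq hβ)
  have hg' : g ∘ n' = fun k : Fin (r + 1) => p' k := funext (h'.emod_eq hβ)
  have hs : StrictMono (g ∘ n) := hg ▸ h.strictMono_p
  have hs' : StrictMono (g ∘ n') := hg' ▸ h'.strictMono_p
  have hgn : g ∘ n = g ∘ n' := by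
    rw [← StrictMono.range_inj hs hs', Set.range_comp, Set.range_comp, hr]
  funext k
  obtain ⟨l, hl⟩ : n k ∈ Set.range n' := hr ▸ ⟨k, rfl⟩
  have : l = k := hs'.injective (by
    rw [← congrFun hgn k, Function.comp_apply, Function.comp_apply, hl])
  rw [← hl, this]

theorem apply_zero (h : IsResolution a b d n c p q) : n 0 = a := by
  have h1 := h.rel 0
  rw [Fin.val_zero, h.chain.q_zero, h.chain.p_zero, zero_mul, add_zero] at h1
  exact_mod_cast mul_left_cancel₀ h.chain.d_pos.ne' h1

theorem apply_last (h : IsResolution a b d n c p q) : n (Fin.last r) = b := by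
  have h1 := h.rel (Fin.last r)
  rw [Fin.val_last, h.chain.q_last, h.chain.p_last, zero_mul, zero_add] at h1
  exact_mod_cast mul_left_cancel₀ h.chain.d_pos.ne' h1

theorem val_one (h : IsResolution a b d n c p q) : ((1 : Fin (r + 1)) : ℕ) = 1 := by
  have := h.chain.one_le
  rw [Fin.val_one', Nat.mod_eq_of_lt (by omega)]

theorem modEq (h : IsResolution a b d n c p q) : d * n 1 ≡ b [MOD a] := by
  have h1 := h.rel 1
  rw [h.val_one, h.chain.p_one, one_mul] at h1
  rw [Nat.modEq_iff_dvd]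
  refine ⟨-q 1, ?_⟩
  push_cast
  linear_combination -h1

theorem isModularConvex (h : IsResolution a b d n c p q) : IsModularConvex n := by
  intro i hi
  refine ⟨c i, ?_⟩
  have h1 := h.rel ⟨i, by omega⟩
  have h2 := h.rel ⟨i + 1, by omega⟩
  have h3 := h.rel ⟨i + 2, hi⟩
  simp only at h1 h2 h3
  rw [smul_eq_mul]
  zify
  apply mul_left_cancel₀ h.chain.d_pos.ne'
  linear_combination h1 + h3 - (c i + 2) * h2 + (a : ℤ) * h.chain.q_rec i (by omega) +
    (b : ℤ) * h.chain.p_rec i (by omega)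

theorem irr_eq_range (h : IsResolution a b d n c p q) (hab : a < b) :
    Irr (quotPair a b d) = Set.range n := by
  have hd := h.chain.d_pos
  have hd' : 0 < d := by exact_mod_cast hd
  have had := h.d_lt_a
  refine Set.Subset.antisymm (fun x hx => mem_of_mem_irr_closure (h.quotPair_eq ▸ hx)) ?_
  rintro _ ⟨k, rfl⟩
  have hk : (k : ℕ) ≤ r := by omega
  have hq0 := h.chain.q_nonneg hk
  have hp0 := h.chain.p_nonneg hk
  have hqd := h.chain.q_le_d hk
  have hpa := h.p_lt_a hk
  have hrel := h.rel k
  refine ⟨h.quotPair_eq ▸ AddSubmonoid.subset_closure ⟨k, rfl⟩, ?_, ?_⟩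
  · intro hn
    rw [hn, Nat.cast_zero, mul_zero] at hrel
    have h1 : q k = 0 := by nlinarith
    have h2 : p k = 0 := by nlinarith
    have hkr : (k : ℕ) = r := h.chain.eq_of_le hk le_rfl
      (h2.trans_le (h.chain.p_nonneg le_rfl)) (h1.trans_le (h.chain.q_nonneg le_rfl))
    rw [hkr, h.chain.p_last] at h2
    omega
  · intro x hx y hy hx0 hy0 hxy
    obtain ⟨s, t, hx⟩ := mem_quotPair.1 hx
    obtain ⟨s', t', hy⟩ := mem_quotPair.1 hy
    have hsum : ((s + s' : ℕ) : ℤ) * a + (t + t' : ℕ) * b = q k * a + p k * b := by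
      rw [← hrel, hxy]
      push_cast
      have hx' : (s : ℤ) * a + t * b = d * x := by exact_mod_cast hx
      have hy' : (s' : ℤ) * a + t' * b = d * y := by exact_mod_cast hy
      linear_combination hx' + hy'
    -- Representations of one number differ by m (b, -a). A negative m makes t + t' negative, since
    -- p k < a; a positive one makes q k ≥ b > d.
    obtain ⟨m, hm⟩ : (a : ℤ) ∣ (t + t' : ℕ) - p k := by
      refine (Nat.isCoprime_iff_coprime.2 h.coprime_ab).dvd_of_dvd_mul_right
        ⟨q k - (s + s' : ℕ), ?_⟩
      linear_combination hsum
    have ha0 : (0 : ℤ) < a := by omega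
    have hm2 : q k = (s + s' : ℕ) + m * b := by
      apply mul_right_cancel₀ ha0.ne'
      linear_combination -hsum + (b : ℤ) * hm
    have hm0 : m = 0 := by
      have hab' : (a : ℤ) < b := by exact_mod_cast hab
      have hda : (d : ℤ) < a := by exact_mod_cast had
      have hs0 := Int.natCast_nonneg (s + s')
      have ht0 := Int.natCast_nonneg (t + t')
      rcases lt_trichotomy m 0 with h1 | h1 | h1
      · nlinarith
      · exact h1
      · nlinarith
    rw [hm0] at hm hm2
    push_cast at hm hm2
    rcases h.chain.eq_zero_of_add_eq (Nat.isCoprime_iff_coprime.2 h.coprime_ad) h.dvd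
      (Int.natCast_nonneg s) (Int.natCast_nonneg t) (Int.natCast_nonneg s')
      (Int.natCast_nonneg t') ⟨x, by exact_mod_cast hx⟩ hk (by linarith) (by linarith)
      with ⟨h1, h2⟩ | ⟨h1, h2⟩
    · rw [Int.natCast_eq_zero] at h1 h2
      rw [h1, h2] at hx
      have := Nat.mul_pos hd' hx0
      omega
    · rw [Int.natCast_eq_zero] at h1 h2
      rw [h1, h2] at hy
      have := Nat.mul_pos hd' hy0
      omega

theorem isAdmissible (h : IsResolution a b d n c p q) (hab : a < b) :
    IsAdmissible (Irr (quotPair a b d)) n where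
  indep := nIndependent_irr _
  injective := h.injective
  range_eq := (h.irr_eq_range hab).symm
  modularConvex := h.isModularConvex
  coprime := by rw [h.apply_zero, h.apply_last]; exact h.coprime_ab
  lt := by rw [h.apply_zero, h.apply_last]; exact hab

/-- As d n 1 ≡ b is a unit modulo a, so is n 1, and it can be cancelled. -/
theorem eq_of_modEq {d' : ℕ} (h : IsResolution a b d n c p q) (hd' : d' < a)
    (hmod : d' * n 1 ≡ b [MOD a]) : d' = d := by
  have hcop : Nat.Coprime a (n 1) := by
    have h1 : Nat.gcd (d * n 1) a = 1 := by
      rw [Nat.ModEq.gcd_eq h.modEq]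
      exact h.coprime_ab.symm
    exact (Nat.Coprime.coprime_mul_left h1).symm
  have h2 := Nat.ModEq.cancel_right_of_coprime hcop (hmod.trans h.modEq.symm)
  exact Nat.ModEq.eq_of_lt_of_lt h2 hd' h.d_lt_a

end IsResolution

/-! ### From triples to sequences -/

/-- The Hirzebruch–Jung continued fraction of `x / y`. -/
theorem exists_hirzebruchJung (x y : ℕ) (hyx : y < x) (hxy : Nat.Coprime x y) :
    ∃ (r : ℕ) (c : ℕ → ℕ) (q : ℕ → ℤ), 1 ≤ r ∧ q 0 = x ∧ q 1 = y ∧ q r = 0 ∧ q (r - 1) = 1 ∧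
      ∀ k, k + 2 ≤ r → q k + q (k + 2) = (c k + 2) * q (k + 1) := by
  induction x using Nat.strong_induction_on generalizing y with
  | _ x ih =>
  rcases y.eq_zero_or_pos with rfl | hy
  · obtain rfl : x = 1 := by simpa using hxy
    exact ⟨1, fun _ => 0, fun k => 1 - k, by norm_num⟩
  -- Here m + 2 is x / y rounded up, at least 2 because y < x; the new remainder is z = (m + 2) y -
  -- x < y.
  · obtain ⟨m, hm1, hm2⟩ : ∃ m : ℕ, x ≤ (m + 2) * y ∧ (m + 2) * y < x + y := by
      have h1 := Nat.div_add_mod (x - 1) y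
      have h2 := Nat.mod_lt (x - 1) hy
      have h3 : 1 ≤ (x - 1) / y := (Nat.one_le_div_iff hy).2 (by omega)
      refine ⟨(x - 1) / y - 1, ?_⟩
      have h4 : ((x - 1) / y - 1 + 2) * y = y * ((x - 1) / y) + y := by
        rw [show (x - 1) / y - 1 + 2 = (x - 1) / y + 1 by omega]
        ring
      omega
    obtain ⟨z, hz⟩ := Nat.exists_eq_add_of_le hm1
    have hyz : Nat.Coprime y z := by
      have h1 : Nat.gcd y (x + z) = y := by
        rw [← hz]
        exact Nat.gcd_eq_left (Dvd.intro_left _ rfl)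
      refine Nat.Coprime.symm (Nat.eq_one_of_dvd_coprimes hxy ?_ ?_)
      · have h2 : Nat.gcd z y ∣ x + z := hz ▸ (Nat.gcd_dvd_right z y).mul_left _
        exact (Nat.dvd_add_left (Nat.gcd_dvd_left z y)).1 h2
      · exact Nat.gcd_dvd_right z y
    obtain ⟨r, c, q, hr, hq0, hq1, hqr, hqr', hrec⟩ := ih y hyx z (by omega) hyz
    refine ⟨r + 1, fun k => Nat.casesOn k m c, fun k => Nat.casesOn k x q, by omega, rfl, hq0,
      hqr, ?_, ?_⟩
    · obtain ⟨r, rfl⟩ := Nat.exists_eq_add_of_le' hr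
      exact hqr'
    · rintro (_ | k) hk
      · change (x : ℤ) + q 1 = (m + 2) * q 0
        rw [hq0, hq1]
        exact_mod_cast hz.symm
      · exact hrec k (by omega)

theorem exists_isResolution {a b d : ℕ} (hab : Nat.Coprime a b) (had : Nat.Coprime a d)
    (hbd : Nat.Coprime b d) (hd : 1 ≤ d) (hda : d < a) :
    ∃ (r : ℕ) (n : Fin (r + 1) → ℕ) (c : ℕ → ℕ) (p q : ℕ → ℤ), IsResolution a b d n c p q := by
  have hd' : (0 : ℤ) < d := by exact_mod_cast hd
  -- e is the residue of -b / a modulo d, so that (e, 1) lies in the lattice; it is the second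
  -- vector of the chain.
  obtain ⟨e, he, hecop, heb⟩ : ∃ e : ℕ, e < d ∧ Nat.Coprime d e ∧ (d : ℤ) ∣ e * a + b := by
    obtain ⟨u, v, huv⟩ := Nat.isCoprime_iff_coprime.2 had
    have h0 := Int.emod_nonneg (-b * u : ℤ) hd'.ne'
    have h1 := Int.emod_lt_of_pos (-b * u : ℤ) hd'
    have h2 := Int.emod_add_mul_ediv (-b * u : ℤ) d
    generalize (-b * u : ℤ) % d = e at h0 h1 h2
    lift e to ℕ using h0
    have hdvd : (d : ℤ) ∣ e * a + b := by
      refine ⟨v * b - a * ((-b * u : ℤ) / d), ?_⟩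
      linear_combination (a : ℤ) * h2 - (b : ℤ) * huv
    refine ⟨e, by exact_mod_cast h1, ?_, hdvd⟩
    refine Nat.eq_one_of_dvd_coprimes hbd ?_ (Nat.gcd_dvd_left d e)
    have h3 : d ∣ e * a + b := by exact_mod_cast hdvd
    exact (Nat.dvd_add_right ((Nat.gcd_dvd_right d e).mul_right a)).1
      ((Nat.gcd_dvd_left d e).trans h3)
  obtain ⟨r, c, q, hr, hq0, hq1, hqr, hqr', hrec⟩ := exists_hirzebruchJung d e he hecop
  let p := recSeq c 0 1
  have hprec : ∀ k, p k + p (k + 2) = (c k + 2) * p (k + 1) := recSeq_rec c 0 1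
  have hdet : ∀ k, k + 1 ≤ r → q k * p (k + 1) - q (k + 1) * p k = d := by
    intro k
    induction k with
    | zero => intro _; simp [p, recSeq, hq0]
    | succ k ih =>
      intro hk
      change q (k + 1) * p (k + 2) - q (k + 2) * p (k + 1) = d
      linear_combination ih (by omega) + q (k + 1) * hprec k - p (k + 1) * hrec k hk
  -- The last determinant, with q (r - 1) = 1 and q r = 0, is p r.
  have hpr : p r = d := by
    have := hdet (r - 1) (by omega)
    rwa [Nat.sub_add_cancel hr, hqr, hqr', zero_mul, sub_zero, one_mul] at this
  have hchain : IsHilbertChain c d r p q :=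
    ⟨hr, rfl, rfl, hpr, hq0, hqr, fun k _ => hprec k, hrec⟩
  have hdvd : ∀ k, (k ≤ r → (d : ℤ) ∣ q k * a + p k * b) ∧
      (k + 1 ≤ r → (d : ℤ) ∣ q (k + 1) * a + p (k + 1) * b) := by
    intro k
    induction k with
    | zero => simp [hq0, hq1, p, recSeq, heb]
    | succ k ih =>
      refine ⟨ih.2, fun hk => ?_⟩
      have := dvd_sub ((ih.2 (by omega)).mul_left (c k + 2)) (ih.1 (by omega))
      refine this.trans (dvd_of_eq ?_)
      change _ = q (k + 2) * a + p (k + 2) * b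
      linear_combination -(a : ℤ) * hrec k hk - (b : ℤ) * hprec k
  refine ⟨r, fun k => ((q k * a + p k * b) / d).toNat, c, p, q, hchain, fun k => ?_, hab, had,
    hda⟩
  have hk : (k : ℕ) ≤ r := by omega
  have h0 : 0 ≤ q k * a + p k * b := add_nonneg
    (mul_nonneg (hchain.q_nonneg hk) (Int.natCast_nonneg a))
    (mul_nonneg (hchain.p_nonneg hk) (Int.natCast_nonneg b))
  rw [Int.toNat_of_nonneg (Int.ediv_nonneg h0 hd'.le), Int.mul_ediv_cancel' ((hdvd k).1 hk)]

/-! ### From sequences to triples -/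

theorem IsAdmissible.exists_isResolution {I : Set ℕ} {r : ℕ} {n : Fin (r + 1) → ℕ}
    (h : IsAdmissible I n) (h0 : 0 ∉ I) (h1 : 1 ∉ I) :
    ∃ (d : ℕ) (c : ℕ → ℕ) (p q : ℕ → ℤ),
      IsResolution (n 0) (n (Fin.last r)) d n c p q ∧ Nat.Coprime (n (Fin.last r)) d := by
  have hmem : ∀ k, n k ∈ I := fun k => h.range_eq ▸ ⟨k, rfl⟩
  have hpos : ∀ k, 0 < n k := fun k => Nat.pos_of_ne_zero fun hk => h0 (hk ▸ hmem k)
  have hr : 1 ≤ r := by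
    by_contra hr
    obtain rfl : r = 0 := by omega
    exact h.lt.ne rfl
  have hone : (1 : Fin (r + 1)) = ⟨1, by omega⟩ := by
    ext
    rw [Fin.val_one', Nat.mod_eq_of_lt (by omega)]
  have hconv : ∀ i : ℕ, ∃ c : ℕ, ∀ hi : i + 2 < r + 1,
      n ⟨i, by omega⟩ + n ⟨i + 2, hi⟩ = (c + 2) * n ⟨i + 1, by omega⟩ := by
    intro i
    by_cases hi : i + 2 < r + 1
    · obtain ⟨c, hc⟩ := h.modularConvex i hi
      exact ⟨c, fun _ => hc⟩
    · exact ⟨0, fun hi' => absurd hi' hi⟩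
  choose c hc using hconv
  let N : ℕ → ℤ := fun k => if hk : k < r + 1 then n ⟨k, hk⟩ else 0
  have hN : ∀ k (hk : k < r + 1), N k = n ⟨k, hk⟩ := fun k hk => dif_pos hk
  have hNrec : ∀ k, k + 2 ≤ r → N k + N (k + 2) = (c k + 2) * N (k + 1) := by
    intro k hk
    rw [hN k (by omega), hN (k + 1) (by omega), hN (k + 2) (by omega)]
    exact_mod_cast hc k (by omega)
  set a := n 0 with ha
  set b := n (Fin.last r) with hb
  have hN0 : N 0 = a := hN 0 (by omega)
  have hNr : N r = b := hN r (by omega)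
  have ha1 : 1 < a := by
    have h2 : a ≠ 1 := fun h2 => h1 (h2 ▸ hmem 0)
    have := hpos 0
    omega
  have ha0 : (0 : ℤ) < a := by omega
  let p := recSeq c 0 1
  have hprec : ∀ k, p k + p (k + 2) = (c k + 2) * p (k + 1) := recSeq_rec c 0 1
  have hpr0 : 0 ≤ p r :=
    (lt_of_rec (p := p) (r := r) rfl rfl (fun k _ => hprec k) (k := 0) hr le_rfl).le
  obtain ⟨d, hd⟩ : ∃ d : ℕ, (d : ℤ) = p r := ⟨(p r).toNat, Int.toNat_of_nonneg hpr0⟩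
  -- Modulo a, both n and p n 1 start with 0, n 1 and obey the same recurrence; k = r gives d n 1 ≡
  -- b.
  have hmod : ∀ k, (k ≤ r → (a : ℤ) ∣ p k * N 1 - N k) ∧
      (k + 1 ≤ r → (a : ℤ) ∣ p (k + 1) * N 1 - N (k + 1)) := by
    intro k
    induction k with
    | zero => simp [p, recSeq, hN0]
    | succ k ih =>
      refine ⟨ih.2, fun hk => ?_⟩
      have := dvd_sub ((ih.2 (by omega)).mul_left (c k + 2)) (ih.1 (by omega))
      refine this.trans (dvd_of_eq ?_)
      change _ = p (k + 2) * N 1 - N (k + 2)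
      linear_combination hNrec k hk - N 1 * hprec k
  obtain ⟨e, he⟩ : (a : ℤ) ∣ d * N 1 - b := by
    have := (hmod r).1 le_rfl
    rwa [← hd, hNr] at this
  -- The initial values d and e = (d n 1 - b)/a make d n k = q k a + p k b true for k = 0, 1;
  -- linearity does the rest.
  let q := recSeq c d e
  have hqrec : ∀ k, q k + q (k + 2) = (c k + 2) * q (k + 1) := recSeq_rec c d e
  have hrel : ∀ k, (k ≤ r → d * N k = q k * a + p k * b) ∧
      (k + 1 ≤ r → d * N (k + 1) = q (k + 1) * a + p (k + 1) * b) := by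
    intro k
    induction k with
    | zero =>
      refine ⟨fun _ => by simp [p, q, recSeq, hN0], fun _ => ?_⟩
      simp only [zero_add, p, q, recSeq]
      linear_combination he
    | succ k ih =>
      refine ⟨ih.2, fun hk => ?_⟩
      change d * N (k + 2) = q (k + 2) * a + p (k + 2) * b
      linear_combination d * hNrec k hk - (a : ℤ) * hqrec k - (b : ℤ) * hprec k +
        (c k + 2) * ih.2 (by omega) - ih.1 (by omega)
  have hqr : q r = 0 := by
    have := (hrel r).1 le_rfl
    rw [hNr, ← hd] at this
    exact (mul_eq_zero.1 (show q r * a = 0 by linarith)).resolve_right ha0.ne'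
  have hchain : IsHilbertChain c d r p q :=
    ⟨hr, rfl, rfl, hd.symm, rfl, hqr, fun k _ => hprec k, fun k _ => hqrec k⟩
  have hrel' : ∀ k : Fin (r + 1), (d : ℤ) * n k = q k * a + p k * b := by
    intro k
    rw [← (hrel k).1 (by omega), hN k k.2]
  have had : Nat.Coprime a d := by
    have h2 : d * n 1 ≡ b [MOD a] := by
      rw [Nat.modEq_iff_dvd]
      refine ⟨-e, ?_⟩
      have := hN 1 (by omega)
      rw [← hone] at this
      rw [this] at he
      push_cast
      linear_combination -he
    have h3 : Nat.gcd (d * n 1) a = 1 := by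
      rw [Nat.ModEq.gcd_eq h2]
      exact h.coprime.symm
    exact (Nat.Coprime.coprime_mul_right h3).symm
  -- From d n (r - 1) = a + p (r - 1) b, a common divisor of b and d divides a.
  have hbd : Nat.Coprime b d := by
    have h2 := hrel' ⟨r - 1, by omega⟩
    simp only at h2
    rw [hchain.q_pred_last, one_mul] at h2
    refine Nat.eq_one_of_dvd_coprimes h.coprime ?_ (Nat.gcd_dvd_left b d)
    have h3 : ((Nat.gcd b d : ℕ) : ℤ) ∣ a := by
      have hgb : ((Nat.gcd b d : ℕ) : ℤ) ∣ b := by exact_mod_cast Nat.gcd_dvd_left b d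
      have hgd : ((Nat.gcd b d : ℕ) : ℤ) ∣ d := by exact_mod_cast Nat.gcd_dvd_right b d
      have := dvd_sub (hgd.mul_right (n ⟨r - 1, by omega⟩ : ℤ)) (hgb.mul_left (p (r - 1)))
      refine this.trans (dvd_of_eq ?_)
      linear_combination h2
    exact_mod_cast h3
  -- If a ≤ d, then (b, d - a) is a nonnegative lattice vector with image b, so b = x n k + y n (k +
  -- 1). Independence forces b itself to occur, hence k + 1 = r and x = 0; but then the first
  -- coordinate is y q r = 0 ≠ b.
  have hda : d < a := by
    by_contra! hda
    have hvec : (b : ℤ) * a + (d - a) * b = d * b := by ring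
    obtain ⟨k, hk, x, y, hx, hy⟩ := hchain.exists_combination (a := a) (b := b)
      (Nat.isCoprime_iff_coprime.2 had)
      (fun k hk => ⟨n ⟨k, by omega⟩, (hrel' ⟨k, by omega⟩).symm⟩) (Int.natCast_nonneg b)
      (t := d - a) (by omega) ⟨b, hvec⟩
    have h2 := hrel' ⟨k, by omega⟩
    have h3 := hrel' ⟨k + 1, by omega⟩
    simp only at h2 h3
    have hsum : b = x * n ⟨k, by omega⟩ + y * n ⟨k + 1, by omega⟩ := by
      zify
      apply mul_left_cancel₀ hchain.d_pos.ne'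
      linear_combination -hvec + (a : ℤ) * hx + (b : ℤ) * hy - x * h2 - y * h3
    have hcl : ∀ (j : ℕ) (hj : j < r) (m : ℕ),
        m * n ⟨j, by omega⟩ ∈ AddSubmonoid.closure (I \ {b}) := by
      intro j hj m
      rw [← smul_eq_mul]
      refine AddSubmonoid.nsmul_mem _ (AddSubmonoid.subset_closure (Set.mem_sdiff_singleton.2
        ⟨hmem _, fun hjb => ?_⟩)) _
      have := congrArg Fin.val (h.injective hjb)
      simp only [Fin.val_last] at this
      omega
    have hb' : b ∉ AddSubmonoid.closure (I \ {b}) := h.indep b (hmem _)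
    rcases hk.lt_or_eq with hk' | rfl
    · have := add_mem (hcl k (by omega) x) (hcl (k + 1) hk' y)
      rw [← hsum] at this
      exact hb' this
    · have hlast : n ⟨k + 1, by omega⟩ = b := rfl
      rw [hlast] at hsum
      rcases y.eq_zero_or_pos with rfl | hy0
      · rw [zero_mul, add_zero] at hsum
        have := hcl k (by omega) x
        rw [← hsum] at this
        exact hb' this
      · have hx0 : x = 0 := by
          by_contra hx0
          have := Nat.mul_pos (Nat.pos_of_ne_zero hx0) (hpos ⟨k, by omega⟩)
          have := Nat.le_mul_of_pos_left b hy0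
          omega
        rw [hx0, hqr] at hx
        have := hpos (Fin.last (k + 1))
        simp only [Nat.cast_zero, zero_mul, mul_zero, add_zero] at hx
        omega
  exact ⟨d, c, p, q, ⟨hchain, hrel', h.coprime, had, hda⟩, hbd⟩

end NumSemigroup

/-! ### The bijection -/

/-- In both parts `n 1` is the second term of the sequence; it exists, since `n 0 < n r` forces
`r ≥ 1`. -/
theorem theorem1 (I : Set ℕ) (hfin : I.Finite) (h0 : 0 ∉ I) (h1 : 1 ∉ I) :
    (∀ (r : ℕ) (n : Fin (r + 1) → ℕ), NumSemigroup.IsAdmissible I n →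
      (∃! d : ℕ, d ∈ Set.Icc 1 (n 0 - 1) ∧ d * n 1 ≡ n (Fin.last r) [MOD n 0]) ∧
      ∀ d ∈ Set.Icc 1 (n 0 - 1), d * n 1 ≡ n (Fin.last r) [MOD n 0] →
        I = NumSemigroup.Irr (NumSemigroup.quotPair (n 0) (n (Fin.last r)) d)) ∧
    (∃ Φ : NumSemigroup.AdmissibleSeq I ≃ NumSemigroup.SolutionTriple I,
      ∀ s : NumSemigroup.AdmissibleSeq I,
        (Φ s).a = s.1.2 0 ∧
        (Φ s).b = s.1.2 (Fin.last s.1.1) ∧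
        (Φ s).d * s.1.2 1 ≡ (Φ s).b [MOD (Φ s).a] ∧
        (1 < (Φ s).d ↔ 2 ≤ s.1.1)) := by
  refine ⟨fun r n h => ?_, ?_⟩
  · obtain ⟨d, c, p, q, hres, -⟩ := h.exists_isResolution h0 h1
    have hd : 0 < d := by exact_mod_cast hres.chain.d_pos
    have hda := hres.d_lt_a
    have huniq : ∀ d' ∈ Set.Icc 1 (n 0 - 1), d' * n 1 ≡ n (Fin.last r) [MOD n 0] → d' = d :=
      fun d' hd' hmod => hres.eq_of_modEq (by have := hd'.1; have := hd'.2; omega) hmod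
    refine ⟨⟨d, ⟨⟨hd, by omega⟩, hres.modEq⟩, fun d' hd' => huniq d' hd'.1 hd'.2⟩, ?_⟩
    intro d' hd' hmod
    rw [huniq d' hd' hmod, hres.irr_eq_range h.lt, h.range_eq]
  · choose d c p q hres hbd using fun s : NumSemigroup.AdmissibleSeq I =>
      s.2.exists_isResolution h0 h1
    let F : NumSemigroup.AdmissibleSeq I → NumSemigroup.SolutionTriple I := fun s =>
      { a := s.1.2 0
        b := s.1.2 (Fin.last s.1.1)
        d := d s
        coprime_ab := s.2.coprime
        coprime_ad := (hres s).coprime_ad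
        coprime_bd := hbd s
        one_le_d := by exact_mod_cast (hres s).chain.d_pos
        d_lt_a := (hres s).d_lt_a
        a_lt_b := s.2.lt
        eq_irr := by rw [(hres s).irr_eq_range s.2.lt, s.2.range_eq] }
    have hF : Function.Bijective F := by
      constructor
      · intro s s' hss
        have e1 : s.1.2 0 = s'.1.2 0 := congrArg NumSemigroup.SolutionTriple.a hss
        have e2 : s.1.2 (Fin.last s.1.1) = s'.1.2 (Fin.last s'.1.1) :=
          congrArg NumSemigroup.SolutionTriple.b hss
        have e3 : d s = d s' := congrArg NumSemigroup.SolutionTriple.d hss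
        have r1 := hres s
        have r2 := hres s'
        rw [e1, e2, e3] at r1
        generalize c s = cs, p s = ps, q s = qs at r1
        generalize c s' = cs', p s' = ps', q s' = qs', d s' = ds at r1 r2
        clear e1 e2 e3 hss
        obtain ⟨⟨r, n⟩, hn⟩ := s
        obtain ⟨⟨r', n'⟩, hn'⟩ := s'
        simp only at r1 r2 hn hn'
        have hcard : r + 1 = r' + 1 := by
          have h2 := Set.ncard_range_of_injective hn.injective
          have h3 := Set.ncard_range_of_injective hn'.injective
          rw [hn.range_eq, Nat.card_fin] at h2
          rw [hn'.range_eq, Nat.card_fin] at h3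
          omega
        obtain rfl : r = r' := by omega
        obtain rfl := r1.eq_of_range_eq r2 (hn.range_eq.trans hn'.range_eq.symm)
        rfl
      · intro t
        obtain ⟨r, n, c, p, q, hr⟩ := NumSemigroup.exists_isResolution t.coprime_ab
          t.coprime_ad t.coprime_bd t.one_le_d t.d_lt_a
        have hadm : NumSemigroup.IsAdmissible I n := by
          have := hr.isAdmissible t.a_lt_b
          rwa [← t.eq_irr] at this
        refine ⟨⟨⟨r, n⟩, hadm⟩, ?_⟩
        have e1 : n 0 = t.a := hr.apply_zero
        have e2 : n (Fin.last r) = t.b := hr.apply_last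
        have hs := hres ⟨⟨r, n⟩, hadm⟩
        -- The chosen d and `t.d` solve the same congruence below a.
        have e3 : d ⟨⟨r, n⟩, hadm⟩ = t.d := by
          refine hr.eq_of_modEq ?_ ?_
          · rw [← e1]; exact hs.d_lt_a
          · rw [← e1, ← e2]; exact hs.modEq
        obtain ⟨a, b, dd⟩ := t
        simp only at e1 e2 e3
        subst e1 e2 e3
        rfl
    refine ⟨Equiv.ofBijective F hF, fun s => ⟨rfl, rfl, (hres s).modEq, ?_⟩⟩
    rw [← (hres s).chain.one_lt_d_iff]
    exact Nat.one_lt_cast.symm
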